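/- Let $-\infty\le a<b\le\infty$ and let $f:(a,b)\to\mathbb R$ be twice continuously differentiable and operator convex on $(a,b)$, i.e. for all self-adjoint elements $A,B$ of any unital $C^*$-algebra with $\mathrm{sp}(A)\cup\mathrm{sp}(B)\subseteq(a,b)$ and all $t\in[0,1]$, $$f(tA+(1-t)B)\le t f(A)+(1-t)f(B),$$ where $f(A)$ is defined by the continuous functional calculus. Then for every $t_1\in(a,b)$ the function $L_{t_1}f:(a,b)\to\mathbb R$, $$L_{t_1}f(t)=\begin{cases}\dfrac{f(t)-f(t_1)}{t-t_1}, & t\neq t_1,\\[2mm] f'(t_1), & t=t_1,\end{cases}$$ is operator monotone on $(a,b)$, i.e. it is continuous and $L_{t_1}f(A)\le L_{t_1}f(B)$ for all self-adjoint elements $A\le B$ of any unital $C^*$-algebra with $\mathrm{sp}(A)\cup\mathrm{sp}(B)\subseteq(a,b)$. -/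

import Mathlib

universe u v

/-- The open interval `(a, b) ⊆ ℝ`, whose end points are allowed to be infinite. -/
def openInterval (a b : EReal) : Set ℝ :=
  {t : ℝ | a < (t : EReal) ∧ (t : EReal) < b}

/-- `f` is operator monotone on the interval `s`: for self-adjoint elements `X ≤ Y` of any unital
C⋆-algebra whose spectra lie in `s` one has `f(X) ≤ f(Y)`. Here `f(X)` is given by the continuous
functional calculus, so that continuity of `f` on `s` is part of the definition. The order of a
C⋆-algebra is determined by `StarOrderedRing`: `X ≤ Y` means that `Y - X` is positive. -/
def OperatorMonotoneOn (f : ℝ → ℝ) (s : Set ℝ) : Prop :=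
  ContinuousOn f s ∧
    ∀ (A : Type u) [CStarAlgebra A] [PartialOrder A] [StarOrderedRing A] (X Y : A),
      IsSelfAdjoint X → IsSelfAdjoint Y → spectrum ℝ X ⊆ s → spectrum ℝ Y ⊆ s →
        X ≤ Y → cfc f X ≤ cfc f Y

/-- `f` is operator convex on the interval `s`: for self-adjoint elements `X`, `Y` of any unital
C⋆-algebra whose spectra lie in `s` and for `t ∈ [0, 1]` one has
`f(t X + (1 - t) Y) ≤ t f(X) + (1 - t) f(Y)`. As above, continuity of `f` on `s` is part of the
definition. -/
def OperatorConvexOn (f : ℝ → ℝ) (s : Set ℝ) : Prop :=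
  ContinuousOn f s ∧
    ∀ (A : Type u) [CStarAlgebra A] [PartialOrder A] [StarOrderedRing A] (X Y : A),
      IsSelfAdjoint X → IsSelfAdjoint Y → spectrum ℝ X ⊆ s → spectrum ℝ Y ⊆ s →
        ∀ t ∈ Set.Icc (0 : ℝ) 1,
          cfc f (t • X + (1 - t) • Y) ≤ t • cfc f X + (1 - t) • cfc f Y

/-- The transform `L_{t₁} f`: the first divided difference of `f` with one argument fixed at `t₁`,
with value `f'(t₁)` at `t₁`. -/
noncomputable def dividedDifferenceTransform (t₁ : ℝ) (f : ℝ → ℝ) : ℝ → ℝ := dslope f t₁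

theorem dividedDifferenceTransform_same (t₁ : ℝ) (f : ℝ → ℝ) :
    dividedDifferenceTransform t₁ f t₁ = deriv f t₁ :=
  dslope_same f t₁

theorem dividedDifferenceTransform_of_ne (t₁ t : ℝ) (f : ℝ → ℝ) (h : t ≠ t₁) :
    dividedDifferenceTransform t₁ f t = (f t - f t₁) / (t - t₁) := by
  rw [dividedDifferenceTransform, dslope_of_ne f h, slope_def_field]

/-! Write `g = dslope f t₁`. Everything rests on a `2 × 2` block computation. Let `y = x - t₁` and
perturb `x ⊕ t₁` by `ε K`, where `K` has off-diagonal entries `k`, `k*`. In the upper left corner of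
a power of `[[y, ε k], [ε k*, 0]]`, an excursion to the second summand must return at once,
contributing `ε² k k*` in place of two factors. To order `ε²`, the corner of the `(n+1)`-st power is
therefore `y ^ (n + 1)` plus the increment of `z ↦ z ^ n` from `y` to `y + ε² k k*`. Since `f -
f(t₁)` is `t - t₁` times `g`, the corner of `f` changes by `g(x + ε² k k*) - g(x) + o(ε²)`, for
either sign of `ε`.

Midpoint convexity at `± ε K` makes this change at least `-o(ε²)`. Hence `g` has nonnegative lower
derivative at `x` in every positive direction `k k*`, and integrating along the segment from `x` to
`y = x + k k*` gives monotonicity (`eventually_le_cfc_dslope_add_smul_sub`,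
`le_of_eventually_neg_mul_le`).

In finite dimension spectra are finite, so Hermite interpolation replaces `f` by a polynomial up to
negligible terms. Compression to Krylov subspaces extends the result to Hilbert spaces, and GNS
representations extend it to C⋆-algebras. Convexity is used only for operators on finite dimensional
spaces, which is why the universes `u` and `v` are independent. -/

open Filter Topology Polynomial Set
open scoped Asymptotics

/-! ### Hermite interpolation of `f` and of its divided difference -/

/-- The **second order Taylor polynomial** of a `C²` function, with its little-o remainder. -/
theorem exists_polynomial_isLittleO_of_contDiffAt {h : ℝ → ℝ} {x : ℝ} (hh : ContDiffAt ℝ 2 h x) :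
    ∃ q : ℝ[X], (fun t ↦ h t - q.eval t) =o[𝓝 x] fun t ↦ (t - x) ^ 2 := by
  obtain ⟨w, hw, hhw⟩ := hh.contDiffOn (m := 2) le_rfl (by simp)
  obtain ⟨ρ, hρ, hball⟩ := Metric.mem_nhds_iff.1 hw
  have key := taylor_isLittleO (n := 2) (convex_ball x ρ) (Metric.mem_ball_self hρ)
    (hhw.mono (hball))
  rw [nhdsWithin_eq_nhds.2 (Metric.ball_mem_nhds x hρ)] at key
  refine ⟨∑ k ∈ Finset.range 3, C ((k.factorial : ℝ)⁻¹ *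
    iteratedDerivWithin k h (Metric.ball x ρ) x) * (X - C x) ^ k, ?_⟩
  refine key.congr_left fun t ↦ ?_
  simp only [taylor_within_apply, eval_finsetSum, eval_mul, eval_C, eval_pow, eval_sub, eval_X,
    smul_eq_mul]
  congr 1
  exact Finset.sum_congr rfl fun k _ ↦ by ring

theorem eval_prod_X_sub_C_ne_zero {S : Finset ℝ} {t : ℝ} (ht : t ∉ S) :
    (∏ l ∈ S, (X - C l)).eval t ≠ 0 := by
  rw [eval_prod]
  refine Finset.prod_ne_zero_iff.2 fun l hl ↦ ?_
  simpa [sub_eq_zero] using fun h : t = l ↦ ht (h ▸ hl)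

/-- **Hermite interpolation** to second order at finitely many points. -/
theorem exists_polynomial_isLittleO_finset {h : ℝ → ℝ} (S : Finset ℝ)
    (hh : ∀ x ∈ S, ContDiffAt ℝ 2 h x) :
    ∃ p : ℝ[X], ∀ x ∈ S, (fun t ↦ h t - p.eval t) =o[𝓝 x] fun t ↦ (t - x) ^ 2 := by
  induction S using Finset.induction_on with
  | empty => exact ⟨0, by simp⟩
  | insert y S hy ih =>
    obtain ⟨p, hp⟩ := ih fun x hx ↦ hh x (Finset.mem_insert_of_mem hx)
    set m : ℝ[X] := ∏ l ∈ S, (X - C l) with hm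
    have hmy : m.eval y ≠ 0 := eval_prod_X_sub_C_ne_zero hy
    -- Division by `m³` is harmless at the new node, and the correction `m³ q` vanishes to third
    -- order at the old nodes, hence is `o((t - x)²)` there.
    have hcd : ContDiffAt ℝ 2 (fun t ↦ (h t - p.eval t) / (m.eval t) ^ 3) y := by
      refine ContDiffAt.div ((hh y (Finset.mem_insert_self _ _)).sub ?_) ?_ (pow_ne_zero _ hmy)
      · exact (by simpa using p.contDiff_aeval (𝕜 := ℝ) 2 |>.contDiffAt)
      · exact (by simpa using (m.contDiff_aeval (𝕜 := ℝ) 2).pow 3 |>.contDiffAt)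
    obtain ⟨q, hq⟩ := exists_polynomial_isLittleO_of_contDiffAt hcd
    refine ⟨p + m ^ 3 * q, fun x hx ↦ ?_⟩
    rcases Finset.mem_insert.1 hx with rfl | hx
    · have h1 : (fun t ↦ m.eval t ^ 3) =O[𝓝 x] (fun _ ↦ (1 : ℝ)) :=
        ((m.continuous.pow 3).tendsto x).isBigO_one ℝ
      have h2 := h1.mul_isLittleO hq
      simp only [one_mul] at h2
      refine h2.congr' ?_ EventuallyEq.rfl
      filter_upwards [m.continuous.continuousAt.eventually_ne hmy] with t ht
      simp only [eval_add, eval_mul, eval_pow]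
      field_simp
      ring
    · obtain ⟨m', hm'⟩ : (X - C x) ∣ m := Finset.dvd_prod_of_mem _ hx
      have h1 : (fun t ↦ (m'.eval t ^ 3 * q.eval t) * (t - x) * (t - x) ^ 2) =o[𝓝 x]
          fun t ↦ (t - x) ^ 2 := by
        have h0 : (fun t ↦ (m'.eval t ^ 3 * q.eval t) * (t - x)) =o[𝓝 x] (fun _ ↦ (1 : ℝ)) := by
          rw [Asymptotics.isLittleO_one_iff]
          have : Continuous (fun t ↦ (m'.eval t ^ 3 * q.eval t) * (t - x)) := by fun_prop
          simpa using this.tendsto x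
        simpa using h0.mul_isBigO (Asymptotics.isBigO_refl (fun t ↦ (t - x) ^ 2) (𝓝 x))
      refine ((hp x hx).sub h1).congr_left fun t ↦ ?_
      simp only [hm', eval_add, eval_mul, eval_pow, eval_sub, eval_X, eval_C]
      ring

/-- A `C²` function is a polynomial up to a remainder vanishing to second order on a finite set. -/
theorem exists_polynomial_add_sq_mul {I : Set ℝ} (hI : IsOpen I) {f : ℝ → ℝ}
    (hf : ContDiffOn ℝ 2 f I) (S : Finset ℝ) (hS : ↑S ⊆ I) :
    ∃ (p : ℝ[X]) (r : ℝ → ℝ), ContinuousOn r I ∧ (∀ x ∈ S, r x = 0) ∧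
      ∀ t ∈ I, f t = p.eval t + ((∏ l ∈ S, (X - C l)).eval t) ^ 2 * r t := by
  obtain ⟨p, hp⟩ := exists_polynomial_isLittleO_finset S
    fun x hx ↦ hf.contDiffAt (hI.mem_nhds (hS hx))
  set m : ℝ[X] := ∏ l ∈ S, (X - C l) with hm
  have hm0 : ∀ x ∈ S, m.eval x = 0 := fun x hx ↦ by
    rw [hm, eval_prod]; exact Finset.prod_eq_zero hx (by simp)
  -- At `t = x` the bound `(t - x)²` is zero, so the little-o estimate forces equality.
  have hfp : ∀ x ∈ S, f x - p.eval x = 0 := fun x hx ↦ by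
    simpa using (hp x hx).isBigO.eq_zero_imp.self_of_nhds
  refine ⟨p, fun t ↦ (f t - p.eval t) / (m.eval t) ^ 2, fun x hx ↦ ?_, fun x hx ↦ ?_,
    fun t ht ↦ ?_⟩
  · refine ContinuousAt.continuousWithinAt ?_
    by_cases hxS : x ∈ S
    · obtain ⟨m', hm'⟩ : ∃ m', m' * (X - C x) = m ∧ m'.eval x ≠ 0 := by
        refine ⟨∏ l ∈ S.erase x, (X - C l), Finset.prod_erase_mul _ _ hxS,
          eval_prod_X_sub_C_ne_zero (by simp)⟩
      have h1 := (hp x hxS).tendsto_div_nhds_zero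
      have h2 : Tendsto (fun t ↦ ((m'.eval t) ^ 2)⁻¹) (𝓝 x) (𝓝 ((m'.eval x) ^ 2)⁻¹) :=
        ((m'.continuous.pow 2).tendsto x).inv₀ (pow_ne_zero _ hm'.2)
      have h3 := h1.mul h2
      rw [zero_mul] at h3
      have h4 : (f x - p.eval x) / (m.eval x) ^ 2 = 0 := by simp [hfp x hxS]
      rw [ContinuousAt, h4]
      refine h3.congr fun t ↦ ?_
      rw [← hm'.1]
      simp only [eval_mul, eval_sub, eval_X, eval_C, mul_pow, div_eq_mul_inv, mul_inv]
      ring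
    · have hmx : m.eval x ≠ 0 := eval_prod_X_sub_C_ne_zero hxS
      refine ContinuousAt.div ?_ (by fun_prop) (pow_ne_zero _ hmx)
      exact (hf.continuousOn.continuousAt (hI.mem_nhds hx)).sub (by fun_prop)
  · simp [hfp x hx]
  · by_cases htS : t ∈ S
    · simp [hm0 t htS, sub_eq_zero.1 (hfp t htS)]
    · have hmx : m.eval t ≠ 0 := eval_prod_X_sub_C_ne_zero htS
      field_simp
      ring

/-- The polynomial expansion of `f` at a finite set containing `t₁` induces one of `dslope f t₁`. -/
theorem exists_polynomial_dslope {I : Set ℝ} (hI : IsOpen I) {f : ℝ → ℝ}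
    (hf : ContDiffOn ℝ 2 f I) {t₁ : ℝ} (ht₁ : t₁ ∈ I) (S : Finset ℝ) (hS : ↑S ⊆ I) :
    ∃ (m m₁ q : ℝ[X]) (c : ℝ) (r : ℝ → ℝ), (∀ x ∈ S, m.eval x = 0) ∧
      ContinuousOn r I ∧ (∀ x ∈ S, r x = 0) ∧
      (∀ t ∈ I, f t = (C c + (X - C t₁) * q).eval t + (m.eval t) ^ 2 * r t) ∧
      ∀ t ∈ I, dslope f t₁ t = q.eval t + m.eval t * (m₁.eval t * r t) := by
  -- With `t₁` as a node, `X - t₁` divides `m`. Dividing by `t - t₁` then costs one factor: `m² r`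
  -- becomes `m m₁ r`.
  obtain ⟨p, r, hr, hr0, hpr⟩ := exists_polynomial_add_sq_mul hI hf (insert t₁ S)
    (by simpa [insert_subset_iff] using ⟨ht₁, hS⟩)
  set m : ℝ[X] := ∏ l ∈ insert t₁ S, (X - C l) with hm
  obtain ⟨m₁, hm₁⟩ : (X - C t₁) ∣ m := Finset.dvd_prod_of_mem _ (Finset.mem_insert_self _ _)
  obtain ⟨q, hq⟩ : (X - C t₁) ∣ p - C (p.eval t₁) := by
    rw [dvd_iff_isRoot]; simp
  have hp : p = C (p.eval t₁) + (X - C t₁) * q := by rw [← hq]; ring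
  have hft₁ : f t₁ = p.eval t₁ := by
    rw [hpr t₁ ht₁, hr0 t₁ (Finset.mem_insert_self _ _)]; simp
  have hne : ∀ t ∈ I, t ≠ t₁ → dslope f t₁ t = q.eval t + m.eval t * (m₁.eval t * r t) := by
    intro t ht htt
    have h0 : t - t₁ ≠ 0 := sub_ne_zero.2 htt
    rw [dslope_of_ne _ htt, slope_def_field, hft₁, hpr t ht, div_eq_iff h0, hm₁]
    nth_rewrite 1 [hp]
    simp only [eval_add, eval_mul, eval_sub, eval_X, eval_C]
    ring
  refine ⟨m, m₁, q, p.eval t₁, r, fun x hx ↦ ?_, hr,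
    fun x hx ↦ hr0 x (Finset.mem_insert_of_mem hx), fun t ht ↦ by rw [← hp]; exact hpr t ht,
    fun t ht ↦ ?_⟩
  · rw [hm, eval_prod]; exact Finset.prod_eq_zero (Finset.mem_insert_of_mem hx) (by simp)
  · rcases eq_or_ne t t₁ with rfl | htt
    · have hd : ContinuousAt (dslope f t) t := continuousAt_dslope_same.2
        ((hf.contDiffAt (hI.mem_nhds ht)).differentiableAt (by simp))
      have hc : ContinuousAt (fun s ↦ q.eval s + m.eval s * (m₁.eval s * r s)) t := by
        have := hr.continuousAt (hI.mem_nhds ht)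
        fun_prop
      refine tendsto_nhds_unique_of_eventuallyEq (hd.mono_left (nhdsWithin_le_nhds (s := {t}ᶜ)))
        (hc.mono_left nhdsWithin_le_nhds) ?_
      filter_upwards [self_mem_nhdsWithin, mem_nhdsWithin_of_mem_nhds (hI.mem_nhds ht)] with s hs hsI
      exact hne s hsI hs
    · exact hne t ht htt

/-! ### First order expansions and corners of block powers -/

/-- First order expansion of a polynomial along a line in a topological algebra. -/
theorem exists_aeval_add_smul {A : Type*} [Ring A] [Algebra ℝ A] [TopologicalSpace A]
    [IsTopologicalRing A] [ContinuousSMul ℝ A] (x k : A) (p : ℝ[X]) :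
    ∃ R : ℝ → A, Continuous R ∧ ∀ δ, aeval (x + δ • k) p = aeval x p + δ • R δ := by
  induction p using Polynomial.induction_on' with
  | add p q hp hq =>
    obtain ⟨R, hR, hR'⟩ := hp
    obtain ⟨S, hS, hS'⟩ := hq
    exact ⟨fun δ ↦ R δ + S δ, hR.add hS, fun δ ↦ by rw [map_add, hR', hS', map_add]; module⟩
  | monomial n c =>
    suffices h : ∃ R : ℝ → A, Continuous R ∧ ∀ δ : ℝ, (x + δ • k) ^ n = x ^ n + δ • R δ by
      obtain ⟨R, hR, hR'⟩ := h
      refine ⟨fun δ ↦ c • R δ, hR.const_smul c, fun δ ↦ ?_⟩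
      simp only [aeval_monomial, hR', ← Algebra.smul_def]
      module
    induction n with
    | zero => exact ⟨0, continuous_const, by simp⟩
    | succ n ih =>
      obtain ⟨R, hR, hR'⟩ := ih
      refine ⟨fun δ ↦ x ^ n * k + R δ * (x + δ • k), by fun_prop, fun δ ↦ ?_⟩
      rw [pow_succ, hR', pow_succ]
      simp only [add_mul, mul_add, smul_mul_assoc, mul_smul_comm, smul_add]
      abel

/-- The sequence `1, x, x² + δh, …` of upper left corners of powers of the block matrix
`[[x, √δ k], [√δ k*, 0]]`, where `h = k k*`. -/
noncomputable def cornerPow {A : Type*} [Ring A] [Algebra ℝ A] (x h : A) (δ : ℝ) : ℕ → A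
  | 0 => 1
  | 1 => x
  | n + 2 => x * cornerPow x h δ (n + 1) + δ • (h * cornerPow x h δ n)

section cornerPow

variable {A : Type*} [Ring A] [Algebra ℝ A] [TopologicalSpace A]
    [IsTopologicalRing A] [ContinuousSMul ℝ A] (x h : A)

theorem continuous_cornerPow (n : ℕ) : Continuous fun δ ↦ cornerPow x h δ n := by
  induction n using Nat.twoStepInduction with
  | zero => exact continuous_const
  | one => exact continuous_const
  | more n h1 h2 => simp only [cornerPow]; fun_prop

/-- Both sides are `x ^ n + O(δ)`. This precision suffices because the recurrence multiplies this
term by `δ`. -/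
theorem exists_cornerPow_eq_pow_add (n : ℕ) :
    ∃ R : ℝ → A, Continuous R ∧ ∀ δ : ℝ, cornerPow x h δ n = (x + δ • h) ^ n + δ • R δ := by
  obtain ⟨S, hS, hS'⟩ := exists_aeval_add_smul x h (X ^ n)
  simp only [map_pow, aeval_X] at hS'
  suffices H : ∃ R : ℝ → A, Continuous R ∧ ∀ δ : ℝ, cornerPow x h δ n = x ^ n + δ • R δ by
    obtain ⟨R, hR, hR'⟩ := H
    exact ⟨fun δ ↦ R δ - S δ, hR.sub hS, fun δ ↦ by rw [hR', hS']; module⟩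
  clear hS' hS S
  induction n using Nat.twoStepInduction with
  | zero => exact ⟨0, continuous_const, by simp [cornerPow]⟩
  | one => exact ⟨0, continuous_const, by simp [cornerPow]⟩
  | more n _ ih =>
    obtain ⟨R, hR, hR'⟩ := ih
    have := continuous_cornerPow x h n
    refine ⟨fun δ ↦ x * R δ + h * cornerPow x h δ n, by fun_prop, fun δ ↦ ?_⟩
    rw [cornerPow, hR', pow_succ' x (n + 1)]
    simp only [mul_add, mul_smul_comm, smul_add]
    abel

/-- The corner of the `(n+1)`-st power agrees to first order in `δ` with
`x ^ (n + 1) + ((x + δ h) ^ n - x ^ n)`. -/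
theorem exists_cornerPow_succ (n : ℕ) :
    ∃ R : ℝ → A, Continuous R ∧ ∀ δ : ℝ, cornerPow x h δ (n + 1) =
      x ^ (n + 1) + ((x + δ • h) ^ n - x ^ n) + δ ^ 2 • R δ := by
  induction n with
  | zero => exact ⟨0, continuous_const, by simp [cornerPow]⟩
  | succ n ih =>
    obtain ⟨R, hR, hR'⟩ := ih
    obtain ⟨S, hS, hS'⟩ := exists_cornerPow_eq_pow_add x h n
    refine ⟨fun δ ↦ x * R δ + h * S δ, by fun_prop, fun δ ↦ ?_⟩
    rw [cornerPow, hR', hS', pow_succ' x (n + 1), pow_succ' (x + δ • h) n, pow_succ' x n]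
    simp only [mul_add, add_mul, mul_sub, mul_smul_comm, smul_mul_assoc, smul_add, smul_smul, sq]
    abel

end cornerPow

/-! ### Perturbation of the functional calculus -/

section CStar

variable {A : Type*} [CStarAlgebra A] {I : Set ℝ}

theorem eventually_spectrum_add_smul_subset (hI : IsOpen I) {x : A} (k : A)
    (hx : spectrum ℝ x ⊆ I) : ∀ᶠ δ : ℝ in 𝓝 0, spectrum ℝ (x + δ • k) ⊆ I := by
  have h1 := (upperHemicontinuous_spectrum ℝ A).upperHemicontinuousAt x I
    (hI.mem_nhdsSet.2 hx)
  have h2 : Tendsto (fun δ : ℝ ↦ x + δ • k) (𝓝 0) (𝓝 x) := by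
    have : Continuous fun δ : ℝ ↦ x + δ • k := by fun_prop
    simpa using this.tendsto 0
  exact (h2.eventually h1).mono fun δ hδ ↦ subset_of_mem_nhdsSet hδ

theorem tendsto_cfc_add_smul (hI : IsOpen I) {x k : A} (hx : IsSelfAdjoint x)
    (hk : IsSelfAdjoint k) (hxI : spectrum ℝ x ⊆ I) {r : ℝ → ℝ} (hr : ContinuousOn r I) :
    Tendsto (fun δ : ℝ ↦ cfc r (x + δ • k)) (𝓝 0) (𝓝 (cfc r x)) := by
  -- A compact neighbourhood of the spectrum inside `I` contains all nearby spectra, giving a fixed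
  -- compact set for continuity of the calculus.
  obtain ⟨K, ⟨hK, hKc⟩, hKI⟩ :=
    (spectrum.isCompact (𝕜 := ℝ) x).nhdsSet_basis_isCompact.mem_iff.mp (hI.mem_nhdsSet.2 hxI)
  have h2 : Tendsto (fun δ : ℝ ↦ x + δ • k) (𝓝 0) (𝓝 x) := by
    have : Continuous fun δ : ℝ ↦ x + δ • k := by fun_prop
    simpa using this.tendsto 0
  have h1 := h2.eventually ((upperHemicontinuous_spectrum ℝ A).upperHemicontinuousAt x K hK)
  exact h2.cfc hKc r (h1.mono fun δ hδ ↦ subset_of_mem_nhdsSet hδ)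
    (Eventually.of_forall fun δ ↦ hx.add ((IsSelfAdjoint.all δ).smul hk))
    (subset_of_mem_nhdsSet hK) hx (hr.mono hKI)

theorem cfc_eq_aeval_add_mul {x : A} (hx : IsSelfAdjoint x) (hxI : spectrum ℝ x ⊆ I)
    {f r : ℝ → ℝ} (hr : ContinuousOn r I) {p m : ℝ[X]}
    (hf : ∀ t ∈ I, f t = p.eval t + m.eval t * r t) :
    cfc f x = aeval x p + aeval x m * cfc r x := by
  have hr' := hr.mono hxI
  rw [cfc_congr (g := fun t ↦ p.eval t + m.eval t * r t) fun t ht ↦ hf t (hxI ht),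
    cfc_add x (fun t ↦ p.eval t) (fun t ↦ m.eval t * r t) (by fun_prop) (by fun_prop),
    cfc_mul (fun t ↦ m.eval t) r x (by fun_prop) (by fun_prop),
    cfc_polynomial p x, cfc_polynomial m x]

theorem aeval_eq_zero_of_spectrum {x : A} (hx : IsSelfAdjoint x) {m : ℝ[X]}
    (hm : ∀ t ∈ spectrum ℝ x, m.eval t = 0) : aeval x m = 0 := by
  rw [← cfc_polynomial m x, cfc_congr (g := fun _ ↦ 0) fun t ht ↦ hm t ht, cfc_const_zero]

theorem isBigO_aeval_add_smul {x : A} (k : A) {m : ℝ[X]} (hm : aeval x m = 0) :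
    (fun δ : ℝ ↦ aeval (x + δ • k) m) =O[𝓝 0] fun δ : ℝ ↦ δ := by
  obtain ⟨R, hR, hR'⟩ := exists_aeval_add_smul x k m
  simp only [hR', hm, zero_add]
  have := (Asymptotics.isBigO_refl (fun δ : ℝ ↦ δ) (𝓝 0)).smul ((hR.tendsto 0).isBigO_one ℝ)
  simpa using this

/-- The functional calculus of a function that is a polynomial up to a remainder `m r`, with `m` and
`r` vanishing on the spectrum of `x`, agrees with that polynomial near `x` up to `o(δ)`. -/
theorem isLittleO_cfc_add_smul_sub_aeval (hI : IsOpen I) {x k : A} (hx : IsSelfAdjoint x)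
    (hk : IsSelfAdjoint k) (hxI : spectrum ℝ x ⊆ I) {f r : ℝ → ℝ} (hr : ContinuousOn r I)
    {p m : ℝ[X]} (hf : ∀ t ∈ I, f t = p.eval t + m.eval t * r t)
    (hm : ∀ t ∈ spectrum ℝ x, m.eval t = 0) (hr0 : ∀ t ∈ spectrum ℝ x, r t = 0) :
    (fun δ : ℝ ↦ cfc f (x + δ • k) - aeval (x + δ • k) p) =o[𝓝 0] fun δ : ℝ ↦ δ := by
  have h1 := isBigO_aeval_add_smul k (aeval_eq_zero_of_spectrum hx hm)
  have h2 : (fun δ : ℝ ↦ cfc r (x + δ • k)) =o[𝓝 0] fun _ ↦ (1 : ℝ) := by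
    rw [Asymptotics.isLittleO_one_iff]
    have := tendsto_cfc_add_smul hI hx hk hxI hr
    rwa [cfc_congr (g := fun _ ↦ 0) fun t ht ↦ hr0 t ht, cfc_const_zero] at this
  have h3 := h1.mul_isLittleO h2
  simp only [mul_one] at h3
  refine h3.congr' ?_ EventuallyEq.rfl
  filter_upwards [eventually_spectrum_add_smul_subset hI k hxI] with δ hδ
  rw [cfc_eq_aeval_add_mul (hx.add ((IsSelfAdjoint.all δ).smul hk)) hδ hr hf]
  abel

/-- Second order analogue of `isLittleO_cfc_add_smul_sub_aeval`, for a remainder `m² r`. -/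
theorem isLittleO_sq_cfc_add_smul_sub_aeval (hI : IsOpen I) {x k : A} (hx : IsSelfAdjoint x)
    (hk : IsSelfAdjoint k) (hxI : spectrum ℝ x ⊆ I) {f r : ℝ → ℝ} (hr : ContinuousOn r I)
    {p m : ℝ[X]} (hf : ∀ t ∈ I, f t = p.eval t + m.eval t ^ 2 * r t)
    (hm : ∀ t ∈ spectrum ℝ x, m.eval t = 0) (hr0 : ∀ t ∈ spectrum ℝ x, r t = 0) :
    (fun δ : ℝ ↦ cfc f (x + δ • k) - aeval (x + δ • k) p) =o[𝓝 0] fun δ : ℝ ↦ δ ^ 2 := by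
  have h1 := isBigO_aeval_add_smul k (aeval_eq_zero_of_spectrum hx hm)
  have h2 : (fun δ : ℝ ↦ cfc r (x + δ • k)) =o[𝓝 0] fun _ ↦ (1 : ℝ) := by
    rw [Asymptotics.isLittleO_one_iff]
    have := tendsto_cfc_add_smul hI hx hk hxI hr
    rwa [cfc_congr (g := fun _ ↦ 0) fun t ht ↦ hr0 t ht, cfc_const_zero] at this
  have h3 := (h1.mul h1).mul_isLittleO h2
  simp only [mul_one, ← sq] at h3
  refine h3.congr' ?_ EventuallyEq.rfl
  filter_upwards [eventually_spectrum_add_smul_subset hI k hxI] with δ hδ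
  rw [cfc_eq_aeval_add_mul (f := f) (p := p) (m := m ^ 2) (hx.add ((IsSelfAdjoint.all δ).smul hk)) hδ hr
    (by simpa using hf), map_pow]
  abel

end CStar

/-! ### Quadratic forms and block operators on Hilbert space -/

open ContinuousLinearMap (adjoint)

section Hilbert

variable {H : Type*} [NormedAddCommGroup H] [InnerProductSpace ℂ H]

theorem ContinuousLinearMap.reApplyInnerSelf_algebraMap (c : ℝ) (v : H) :
    (algebraMap ℝ (H →L[ℂ] H) c).reApplyInnerSelf v = c * ‖v‖ ^ 2 := by
  rw [Algebra.algebraMap_eq_smul_one, ContinuousLinearMap.reApplyInnerSelf]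
  simp [inner_smul_left_eq_smul, inner_self_eq_norm_sq_to_K, ← Complex.ofReal_pow]

/-- Spectral values are roots of the minimal polynomial. Finiteness lets them serve as interpolation
nodes. -/
theorem ContinuousLinearMap.finite_real_spectrum [FiniteDimensional ℂ H] (T : H →L[ℂ] H) :
    (spectrum ℝ T).Finite := by
  have hint : IsIntegral ℝ T := IsIntegral.of_finite ℝ T
  refine ((minpoly ℝ T).rootSet_finite ℝ).subset fun t ht ↦ ?_
  have h1 := spectrum.subset_polynomial_aeval T (minpoly ℝ T) ⟨t, ht, rfl⟩
  rw [minpoly.aeval] at h1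
  have : Nontrivial (H →L[ℂ] H) := by
    by_contra hn
    rw [not_nontrivial_iff_subsingleton] at hn
    simp [spectrum.of_subsingleton] at ht
  rw [spectrum.zero_eq, mem_singleton_iff] at h1
  rw [mem_rootSet]
  exact ⟨minpoly.ne_zero hint, by simpa using h1⟩

theorem ContinuousLinearMap.abs_reApplyInnerSelf_le (T : H →L[ℂ] H) (v : H) :
    |T.reApplyInnerSelf v| ≤ ‖T‖ * ‖v‖ ^ 2 := by
  calc |T.reApplyInnerSelf v| ≤ ‖inner ℂ (T v) v‖ := RCLike.abs_re_le_norm _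
    _ ≤ ‖T v‖ * ‖v‖ := norm_inner_le_norm _ _
    _ ≤ (‖T‖ * ‖v‖) * ‖v‖ := by gcongr; exact T.le_opNorm v
    _ = _ := by ring

theorem ContinuousLinearMap.reApplyInnerSelf_add (S T : H →L[ℂ] H) (v : H) :
    (S + T).reApplyInnerSelf v = S.reApplyInnerSelf v + T.reApplyInnerSelf v := by
  simp [ContinuousLinearMap.reApplyInnerSelf, inner_add_left]

theorem ContinuousLinearMap.reApplyInnerSelf_sub (S T : H →L[ℂ] H) (v : H) :
    (S - T).reApplyInnerSelf v = S.reApplyInnerSelf v - T.reApplyInnerSelf v := by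
  simp [ContinuousLinearMap.reApplyInnerSelf, inner_sub_left]

theorem ContinuousLinearMap.reApplyInnerSelf_real_smul (c : ℝ) (T : H →L[ℂ] H) (v : H) :
    (c • T).reApplyInnerSelf v = c * T.reApplyInnerSelf v := by
  simp [ContinuousLinearMap.reApplyInnerSelf, inner_smul_left_eq_smul]

theorem ContinuousLinearMap.isLittleO_reApplyInnerSelf {F : ℝ → H →L[ℂ] H} {e : ℝ → ℝ}
    {l : Filter ℝ} (hF : F =o[l] e) (v : H) : (fun t ↦ (F t).reApplyInnerSelf v) =o[l] e := by
  refine Asymptotics.IsBigO.trans_isLittleO (g := F) ?_ hF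
  refine Asymptotics.IsBigO.of_bound (‖v‖ ^ 2) (Eventually.of_forall fun t ↦ ?_)
  rw [mul_comm, Real.norm_eq_abs]
  exact (F t).abs_reApplyInnerSelf_le v

theorem ContinuousLinearMap.continuous_reApplyInnerSelf' (v : H) :
    Continuous fun T : H →L[ℂ] H ↦ T.reApplyInnerSelf v := by
  unfold ContinuousLinearMap.reApplyInnerSelf
  fun_prop

variable [CompleteSpace H]

theorem ContinuousLinearMap.le_iff_reApplyInnerSelf {S T : H →L[ℂ] H} (hS : IsSelfAdjoint S)
    (hT : IsSelfAdjoint T) :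
    S ≤ T ↔ ∀ v, S.reApplyInnerSelf v ≤ T.reApplyInnerSelf v := by
  rw [ContinuousLinearMap.le_def, ContinuousLinearMap.isPositive_def']
  simp [hT.sub hS, ContinuousLinearMap.reApplyInnerSelf, inner_sub_left]

theorem ContinuousLinearMap.spectrum_subset_Icc_iff {T : H →L[ℂ] H} (hT : IsSelfAdjoint T)
    (c d : ℝ) : spectrum ℝ T ⊆ Icc c d ↔
      ∀ v, c * ‖v‖ ^ 2 ≤ T.reApplyInnerSelf v ∧ T.reApplyInnerSelf v ≤ d * ‖v‖ ^ 2 := by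
  have h1 := algebraMap_le_iff_le_spectrum (r := c) hT
  have h2 := le_algebraMap_iff_spectrum_le (r := d) hT
  rw [ContinuousLinearMap.le_iff_reApplyInnerSelf (.algebraMap _ (.all c)) hT] at h1
  rw [ContinuousLinearMap.le_iff_reApplyInnerSelf hT (.algebraMap _ (.all d))] at h2
  simp only [ContinuousLinearMap.reApplyInnerSelf_algebraMap] at h1 h2
  simp only [forall_and, h1, h2, subset_def, mem_Icc]

/-- The canonical inclusions of the two summands of `H ⊕ H`. -/
theorem exists_orthogonal_isometries : ∃ J₁ J₂ : H →L[ℂ] WithLp 2 (H × H),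
    (∀ u, adjoint J₁ (J₁ u) = u) ∧ (∀ u, adjoint J₁ (J₂ u) = 0) ∧
    (∀ u, adjoint J₂ (J₁ u) = 0) ∧ (∀ u, adjoint J₂ (J₂ u) = u) ∧ ∀ u, ‖J₁ u‖ = ‖u‖ := by
  let e := (WithLp.prodContinuousLinearEquiv 2 ℂ H H).symm
  let J₁ : H →L[ℂ] WithLp 2 (H × H) := e.toContinuousLinearMap ∘SL .inl ℂ H H
  let J₂ : H →L[ℂ] WithLp 2 (H × H) := e.toContinuousLinearMap ∘SL .inr ℂ H H
  have h1 : ∀ u, J₁ u = WithLp.toLp 2 (u, 0) := fun _ ↦ rfl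
  have h2 : ∀ u, J₂ u = WithLp.toLp 2 (0, u) := fun _ ↦ rfl
  refine ⟨J₁, J₂, fun u ↦ ?_, fun u ↦ ?_, fun u ↦ ?_, fun u ↦ ?_, fun u ↦ ?_⟩
  · refine ext_inner_right ℂ fun w ↦ ?_
    simp [ContinuousLinearMap.adjoint_inner_left, h1]
  · refine ext_inner_right ℂ fun w ↦ ?_
    simp [ContinuousLinearMap.adjoint_inner_left, h1, h2]
  · refine ext_inner_right ℂ fun w ↦ ?_
    simp [ContinuousLinearMap.adjoint_inner_left, h1, h2]
  · refine ext_inner_right ℂ fun w ↦ ?_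
    simp [ContinuousLinearMap.adjoint_inner_left, h2]
  · simp [h1]

variable {W : Type*} [NormedAddCommGroup W] [InnerProductSpace ℂ W] [CompleteSpace W]

/-- The compression of `(J x J* + ε K) ^ (n + 1)`, where `K = J₁ k J₂* + J₂ k* J₁*`. -/
theorem block_pow_succ_apply {J₁ J₂ : H →L[ℂ] W}
    (h11 : ∀ u, adjoint J₁ (J₁ u) = u) (h12 : ∀ u, adjoint J₁ (J₂ u) = 0)
    (h21 : ∀ u, adjoint J₂ (J₁ u) = 0) (h22 : ∀ u, adjoint J₂ (J₂ u) = u)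
    (x k : H →L[ℂ] H) (ε : ℝ) (n : ℕ) (v : H) :
    ((J₁ ∘SL x ∘SL adjoint J₁ + ε • (J₁ ∘SL k ∘SL adjoint J₂ +
      J₂ ∘SL adjoint k ∘SL adjoint J₁)) ^ (n + 1)) (J₁ v) =
      J₁ (cornerPow x (k * adjoint k) (ε ^ 2) (n + 1) v) +
        ε • J₂ (adjoint k (cornerPow x (k * adjoint k) (ε ^ 2) n v)) := by
  induction n with
  | zero => simp [cornerPow, h11, h21]
  | succ n ih =>
    rw [pow_succ', mul_apply_eq_comp, ih]
    simp only [map_add, add_apply, ContinuousLinearMap.comp_apply,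
      smul_apply, h11, h12, h21, h22, map_zero, ContinuousLinearMap.map_smul_of_tower,
      mul_apply_eq_comp, cornerPow, smul_add, smul_zero, add_zero, zero_add, sq,
      smul_smul]
    abel

/-- The compression of `p(J x J* + ε K)` to the first summand, for a polynomial `p` with zero
constant term. -/
theorem exists_reApplyInnerSelf_block {J₁ J₂ : H →L[ℂ] W}
    (h11 : ∀ u, adjoint J₁ (J₁ u) = u) (h12 : ∀ u, adjoint J₁ (J₂ u) = 0)
    (h21 : ∀ u, adjoint J₂ (J₁ u) = 0) (h22 : ∀ u, adjoint J₂ (J₂ u) = u)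
    (x k : H →L[ℂ] H) (q : ℝ[X]) :
    ∃ R : ℝ → H →L[ℂ] H, Continuous R ∧ ∀ (ε : ℝ) (v : H),
      (aeval (J₁ ∘SL x ∘SL adjoint J₁ + ε • (J₁ ∘SL k ∘SL adjoint J₂ +
        J₂ ∘SL adjoint k ∘SL adjoint J₁)) (X * q)).reApplyInnerSelf (J₁ v) =
      (aeval x (X * q) + (aeval (x + ε ^ 2 • (k * adjoint k)) q - aeval x q) +
        (ε ^ 2) ^ 2 • R (ε ^ 2)).reApplyInnerSelf v := by
  induction q using Polynomial.induction_on' with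
  | add p q hp hq =>
    obtain ⟨R, hR, hR'⟩ := hp
    obtain ⟨S, hS, hS'⟩ := hq
    refine ⟨fun δ ↦ R δ + S δ, hR.add hS, fun ε v ↦ ?_⟩
    rw [mul_add, map_add, ContinuousLinearMap.reApplyInnerSelf_add, hR', hS',
      ← ContinuousLinearMap.reApplyInnerSelf_add]
    congr 1
    simp only [map_add]
    module
  | monomial n c =>
    obtain ⟨R, hR, hR'⟩ := exists_cornerPow_succ x (k * adjoint k) n
    refine ⟨fun δ ↦ c • R δ, hR.const_smul c, fun ε v ↦ ?_⟩
    rw [X_mul_monomial]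
    simp only [aeval_monomial, ← Algebra.smul_def]
    rw [ContinuousLinearMap.reApplyInnerSelf_real_smul, smul_comm _ c, ← smul_sub, ← smul_add,
      ← smul_add, ContinuousLinearMap.reApplyInnerSelf_real_smul, ← hR']
    congr 1
    rw [ContinuousLinearMap.reApplyInnerSelf, block_pow_succ_apply h11 h12 h21 h22,
      inner_add_left, inner_smul_left_eq_smul, ← ContinuousLinearMap.adjoint_inner_right J₁,
      ← ContinuousLinearMap.adjoint_inner_right J₂, h11, h21]
    simp [ContinuousLinearMap.reApplyInnerSelf]

end Hilbert

/-! ### The finite dimensional case -/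

/-- Centring at `t` produces the multiple of `X` required by `exists_reApplyInnerSelf_block`, whose
second diagonal block is zero. -/
theorem aeval_algebraMap_add {A : Type*} [Ring A] [Algebra ℝ A] (t c : ℝ) (x : A) (q : ℝ[X]) :
    aeval (algebraMap ℝ A t + x) (C c + (X - C t) * q) =
      algebraMap ℝ A c + aeval x (X * q.comp (X + C t)) := by
  simp [aeval_comp, add_comm x]

section FiniteDimensional

variable {E : Type u} [NormedAddCommGroup E] [InnerProductSpace ℂ E] [CompleteSpace E]

/-- If the spectrum of `x` and the point `t` lie in `[c, d]`, then so does the spectrum of the block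
diagonal operator `x ⊕ t`. -/
theorem spectrum_block_subset {W : Type*} [NormedAddCommGroup W] [InnerProductSpace ℂ W]
    [CompleteSpace W] {J : E →L[ℂ] W} (hJ : ∀ u, ‖J u‖ = ‖u‖) {x : E →L[ℂ] E}
    (hx : IsSelfAdjoint x) {c d t : ℝ} (hxs : spectrum ℝ x ⊆ Icc c d) (ht : t ∈ Icc c d)
    (hZ : IsSelfAdjoint (algebraMap ℝ (W →L[ℂ] W) t +
      J ∘SL (x - algebraMap ℝ (E →L[ℂ] E) t) ∘SL adjoint J)) :
    spectrum ℝ (algebraMap ℝ (W →L[ℂ] W) t +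
      J ∘SL (x - algebraMap ℝ (E →L[ℂ] E) t) ∘SL adjoint J) ⊆ Icc c d := by
  rw [ContinuousLinearMap.spectrum_subset_Icc_iff hx] at hxs
  rw [ContinuousLinearMap.spectrum_subset_Icc_iff hZ]
  intro w
  have h1 : (J ∘SL (x - algebraMap ℝ (E →L[ℂ] E) t) ∘SL adjoint J).reApplyInnerSelf w =
      x.reApplyInnerSelf (adjoint J w) - t * ‖adjoint J w‖ ^ 2 := by
    rw [← ContinuousLinearMap.reApplyInnerSelf_algebraMap,
      ← ContinuousLinearMap.reApplyInnerSelf_sub]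
    simp only [ContinuousLinearMap.reApplyInnerSelf, ContinuousLinearMap.comp_apply]
    rw [← ContinuousLinearMap.adjoint_inner_right]
  have h2 : ‖adjoint J w‖ ^ 2 ≤ ‖w‖ ^ 2 := by
    have hJ1 : ‖adjoint J‖ ≤ 1 := by
      rw [LinearIsometryEquiv.norm_map]
      exact J.opNorm_le_bound zero_le_one fun u ↦ by simp [hJ]
    have := (adjoint J).le_of_opNorm_le hJ1 w
    rw [one_mul] at this
    gcongr
  obtain ⟨h3, h4⟩ := hxs (adjoint J w)
  rw [ContinuousLinearMap.reApplyInnerSelf_add, ContinuousLinearMap.reApplyInnerSelf_algebraMap, h1]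
  -- The form is that of `x` at `J* w` plus `t (‖w‖² - ‖J* w‖²)`, with a nonnegative bracket.
  constructor <;> nlinarith [ht.1, ht.2]

variable [FiniteDimensional ℂ E] {I : Set ℝ}

/-- Operator convexity of `f` at a `2 × 2` block perturbation of `x ⊕ t₁` bounds the lower
derivative of `dslope f t₁` at `x` in the direction `k k*`. -/
theorem eventually_le_cfc_dslope_add_smul_sub (hI : IsOpen I) (hIc : I.OrdConnected) {f : ℝ → ℝ}
    (hf : ContDiffOn ℝ 2 f I) (hconv : OperatorConvexOn.{u} f I) {t₁ c d : ℝ}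
    (hc : c ∈ I) (hd : d ∈ I) (ht₁ : t₁ ∈ Icc c d)
    {W : Type u} [NormedAddCommGroup W] [InnerProductSpace ℂ W] [CompleteSpace W]
    [FiniteDimensional ℂ W] {J₁ J₂ : E →L[ℂ] W}
    (h11 : ∀ u, adjoint J₁ (J₁ u) = u) (h12 : ∀ u, adjoint J₁ (J₂ u) = 0)
    (h21 : ∀ u, adjoint J₂ (J₁ u) = 0) (h22 : ∀ u, adjoint J₂ (J₂ u) = u)
    (hJ : ∀ u, ‖J₁ u‖ = ‖u‖) {x : E →L[ℂ] E} (hx : IsSelfAdjoint x)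
    (hxs : spectrum ℝ x ⊆ Icc c d) (k : E →L[ℂ] E) (v : E) {r : ℝ} (hr : 0 < r) :
    ∀ᶠ δ : ℝ in 𝓝[>] 0, -(r * δ) ≤ (cfc (dslope f t₁) (x + δ • (k * star k))).reApplyInnerSelf v -
      (cfc (dslope f t₁) x).reApplyInnerSelf v := by
  have hcd : Icc c d ⊆ I := hIc.out hc hd
  set y := x - algebraMap ℝ (E →L[ℂ] E) t₁ with hy
  have hxy : x = algebraMap ℝ (E →L[ℂ] E) t₁ + y := by rw [hy]; abel
  have hya : IsSelfAdjoint y := hx.sub (.algebraMap _ (.all t₁))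
  set N := J₁ ∘SL y ∘SL adjoint J₁ with hN
  set K := J₁ ∘SL k ∘SL adjoint J₂ + J₂ ∘SL adjoint k ∘SL adjoint J₁ with hK
  have hKa : IsSelfAdjoint K := by
    rw [ContinuousLinearMap.isSelfAdjoint_iff', hK]
    simp [ContinuousLinearMap.adjoint_comp, ContinuousLinearMap.comp_assoc, add_comm]
  have hNa : IsSelfAdjoint N := by
    rw [ContinuousLinearMap.isSelfAdjoint_iff', hN]
    simp [ContinuousLinearMap.adjoint_comp, ContinuousLinearMap.comp_assoc, hya.adjoint_eq]
  set Z := algebraMap ℝ (W →L[ℂ] W) t₁ + N with hZ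
  have hZa : IsSelfAdjoint Z := .add (.algebraMap _ (.all t₁)) hNa
  have hZs : spectrum ℝ Z ⊆ I := (spectrum_block_subset hJ hx hxs ht₁ hZa).trans hcd
  have hHa : IsSelfAdjoint (k * star k) := .mul_star_self k
  -- Nodes at both spectra let one expansion serve `f` at `Z` and `dslope f t₁` at `x`.
  set S := Z.finite_real_spectrum.toFinset ∪ x.finite_real_spectrum.toFinset with hS
  obtain ⟨m, m₁, q, c₀, s, hm, hs, hs0, hfe, hge⟩ :=
    exists_polynomial_dslope hI hf (hcd ht₁) S (by simpa [hS] using ⟨hZs, hxs.trans hcd⟩)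
  set p : ℝ[X] := C c₀ + (X - C t₁) * q
  have e1 := ContinuousLinearMap.isLittleO_reApplyInnerSelf (isLittleO_sq_cfc_add_smul_sub_aeval
    hI hZa hKa hZs hs hfe (fun t ht ↦ hm t (by simp [hS, ht]))
    (fun t ht ↦ hs0 t (by simp [hS, ht]))) (J₁ v)
  have e2 := ContinuousLinearMap.isLittleO_reApplyInnerSelf (isLittleO_cfc_add_smul_sub_aeval
    hI hx hHa (hxs.trans hcd) (r := fun t ↦ m₁.eval t * s t) (by fun_prop) hge
    (fun t ht ↦ hm t (by simp [hS, ht])) (fun t ht ↦ by simp [hs0 t (by simp [hS, ht])])) v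
  obtain ⟨R, hR, hR'⟩ := exists_reApplyInnerSelf_block h11 h12 h21 h22 y k (q.comp (X + C t₁))
  have hpZ : ∀ ε : ℝ, (aeval (Z + ε • K) p).reApplyInnerSelf (J₁ v) =
      c₀ * ‖v‖ ^ 2 + (aeval y (X * q.comp (X + C t₁))).reApplyInnerSelf v +
      ((aeval (x + ε ^ 2 • (k * star k)) q).reApplyInnerSelf v - (aeval x q).reApplyInnerSelf v) +
      (ε ^ 2) ^ 2 * (R (ε ^ 2)).reApplyInnerSelf v := by
    intro ε
    have hcomp : ∀ z : E →L[ℂ] E, aeval z (q.comp (X + C t₁)) =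
        aeval (algebraMap ℝ (E →L[ℂ] E) t₁ + z) q := fun z ↦ by simp [aeval_comp, add_comm z]
    rw [hZ, add_assoc, aeval_algebraMap_add, ContinuousLinearMap.reApplyInnerSelf_add,
      ContinuousLinearMap.reApplyInnerSelf_algebraMap, hJ, hR', hcomp, hcomp, ← hxy, ← add_assoc,
      ← hxy, ContinuousLinearMap.reApplyInnerSelf_add, ContinuousLinearMap.reApplyInnerSelf_add,
      ContinuousLinearMap.reApplyInnerSelf_sub, ContinuousLinearMap.reApplyInnerSelf_real_smul]
    rw [ContinuousLinearMap.star_eq_adjoint]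
    ring
  simp only [ContinuousLinearMap.reApplyInnerSelf_sub, hpZ] at e1 e2
  -- At `ε = 0` the little-o bounds are exact equalities, identifying the constant terms.
  have e10 := e1.isBigO.eq_zero_imp.self_of_nhds
  have e20 := e2.isBigO.eq_zero_imp.self_of_nhds
  simp only [ne_eq, OfNat.ofNat_ne_zero, not_false_eq_true, zero_pow, zero_smul, add_zero, sub_self,
    zero_mul, forall_const] at e10 e20
  have hneg : Tendsto (fun ε : ℝ ↦ -ε) (𝓝 0) (𝓝 0) := by simpa using (continuous_neg (G := ℝ)).tendsto 0
  have hsq : Tendsto (fun ε : ℝ ↦ ε ^ 2) (𝓝 0) (𝓝 0) := by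
    simpa using (continuous_pow (M := ℝ) 2).tendsto 0
  have e1' := e1.comp_tendsto hneg
  -- The remainder for `dslope f t₁` is only `o(δ)`, but it is used at `δ = ε²`.
  have e2' := e2.comp_tendsto hsq
  have e3 : (fun ε : ℝ ↦ (ε ^ 2) ^ 2 * (R (ε ^ 2)).reApplyInnerSelf v) =o[𝓝 0]
      fun ε : ℝ ↦ ε ^ 2 := by
    have h0 : (fun ε : ℝ ↦ ε ^ 2 * (R (ε ^ 2)).reApplyInnerSelf v) =o[𝓝 0] fun _ ↦ (1 : ℝ) := by
      rw [Asymptotics.isLittleO_one_iff]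
      have : Continuous fun ε : ℝ ↦ ε ^ 2 * (R (ε ^ 2)).reApplyInnerSelf v := by
        have := ContinuousLinearMap.continuous_reApplyInnerSelf' v
        fun_prop
      simpa using this.tendsto 0
    have := (Asymptotics.isBigO_refl (fun ε : ℝ ↦ ε ^ 2) (𝓝 0)).mul_isLittleO h0
    simpa [sq, mul_assoc] using this
  simp only [Function.comp_def, neg_sq] at e1' e2'
  have b1 := e1.bound (show 0 < r / 4 by positivity)
  have b1' := e1'.bound (show 0 < r / 4 by positivity)
  have b2 := e2'.bound (show 0 < r / 4 by positivity)
  have b3 := e3.bound (show 0 < r / 4 by positivity)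
  have hs1 := eventually_spectrum_add_smul_subset hI K hZs
  have hs2 := hneg.eventually hs1
  have key : ∀ᶠ ε : ℝ in 𝓝 0, -(r * ε ^ 2) ≤
      (cfc (dslope f t₁) (x + ε ^ 2 • (k * star k))).reApplyInnerSelf v -
      (cfc (dslope f t₁) x).reApplyInnerSelf v := by
    filter_upwards [b1, b1', b2, b3, hs1, hs2] with ε b1 b1' b2 b3 hs1 hs2
    have ha : ∀ ε : ℝ, IsSelfAdjoint (Z + ε • K) := fun ε ↦ hZa.add ((IsSelfAdjoint.all ε).smul hKa)
    have hcv := hconv.2 _ (Z + ε • K) (Z + (-ε) • K) (ha _) (ha _) hs1 hs2 (1 / 2)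
      ⟨by norm_num, by norm_num⟩
    have hmid : (1 / 2 : ℝ) • (Z + ε • K) + (1 - 1 / 2 : ℝ) • (Z + (-ε) • K) = Z := by module
    rw [hmid] at hcv
    have hcv' := (ContinuousLinearMap.isPositive_def.1 hcv).2 (J₁ v)
    simp only [ContinuousLinearMap.reApplyInnerSelf_sub, ContinuousLinearMap.reApplyInnerSelf_add,
      ContinuousLinearMap.reApplyInnerSelf_real_smul] at hcv'
    simp only [Real.norm_eq_abs, abs_of_nonneg (sq_nonneg ε)] at b1 b1' b2 b3
    rw [abs_le] at b1 b1' b2 b3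
    linarith [b1.2, b1'.2, b2.1, b3.2]
  -- Substituting `ε = √δ` returns to the direction `δ k k*`.
  have hsqrt : Tendsto Real.sqrt (𝓝[>] 0) (𝓝 0) := by
    simpa using (Real.continuous_sqrt.tendsto 0).mono_left nhdsWithin_le_nhds
  filter_upwards [hsqrt.eventually key, self_mem_nhdsWithin] with δ hδ hδ0
  rwa [Real.sq_sqrt (le_of_lt hδ0)] at hδ

/-- A function with nonnegative lower right derivative is monotone. -/
theorem le_of_eventually_neg_mul_le {φ : ℝ → ℝ} (hφ : ContinuousOn φ (Icc 0 1))
    (h : ∀ τ ∈ Ico (0 : ℝ) 1, ∀ r > 0, ∀ᶠ δ in 𝓝[>] (0 : ℝ), -(r * δ) ≤ φ (τ + δ) - φ τ) :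
    φ 0 ≤ φ 1 := by
  -- The fencing inequality is applied to `-φ` against the constant `-φ 0`; the later choice `r / 2`
  -- makes the slope bound strict.
  have := image_le_of_liminf_slope_right_le_deriv_boundary (f := fun t ↦ -φ t) (a := 0) (b := 1)
    hφ.neg (B := fun _ ↦ -φ 0) (B' := fun _ ↦ 0) le_rfl continuousOn_const
    (fun x _ ↦ hasDerivWithinAt_const _ _ _) ?_ (right_mem_Icc.2 zero_le_one)
  · simpa using this
  intro τ hτ r hr
  refine Eventually.frequently ?_
  have h1 := h τ hτ (r / 2) (by positivity)
  have h2 : Tendsto (fun z ↦ z - τ) (𝓝[>] τ) (𝓝[>] 0) := by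
    refine tendsto_nhdsWithin_iff.2 ⟨?_, ?_⟩
    · have : Continuous fun z : ℝ ↦ z - τ := by fun_prop
      simpa using (this.tendsto τ).mono_left (nhdsWithin_le_nhds (s := Ioi τ))
    · filter_upwards [self_mem_nhdsWithin] with z hz using sub_pos.2 (mem_Ioi.1 hz)
  filter_upwards [h2.eventually h1, self_mem_nhdsWithin] with z hz hzτ
  have hpos : 0 < z - τ := sub_pos.2 (mem_Ioi.1 hzτ)
  rw [slope_def_field, div_lt_iff₀ hpos]
  rw [add_sub_cancel] at hz
  nlinarith

theorem cfc_dslope_le_of_finiteDimensional (hI : IsOpen I) (hIc : I.OrdConnected) {f : ℝ → ℝ}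
    (hf : ContDiffOn ℝ 2 f I) (hconv : OperatorConvexOn.{u} f I) {t₁ c d : ℝ}
    (hc : c ∈ I) (hd : d ∈ I) (ht₁ : t₁ ∈ Icc c d) {x y : E →L[ℂ] E} (hx : IsSelfAdjoint x)
    (hy : IsSelfAdjoint y) (hxs : spectrum ℝ x ⊆ Icc c d) (hys : spectrum ℝ y ⊆ Icc c d)
    (hxy : x ≤ y) : cfc (dslope f t₁) x ≤ cfc (dslope f t₁) y := by
  have hcd : Icc c d ⊆ I := hIc.out hc hd
  obtain ⟨J₁, J₂, h11, h12, h21, h22, hJ⟩ := exists_orthogonal_isometries (H := E)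
  obtain ⟨k, hk⟩ := CStarAlgebra.nonneg_iff_eq_mul_star_self.1 (sub_nonneg.2 hxy)
  have hHa : IsSelfAdjoint (k * star k) := .mul_star_self k
  have hya : y = x + (1 : ℝ) • (k * star k) := by rw [← hk]; simp
  have hsa : ∀ τ : ℝ, IsSelfAdjoint (x + τ • (k * star k)) :=
    fun τ ↦ hx.add ((IsSelfAdjoint.all τ).smul hHa)
  have hsp : ∀ τ ∈ Icc (0 : ℝ) 1, spectrum ℝ (x + τ • (k * star k)) ⊆ Icc c d := by
    intro τ hτ
    rw [ContinuousLinearMap.spectrum_subset_Icc_iff (hsa τ)]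
    rw [ContinuousLinearMap.spectrum_subset_Icc_iff hx] at hxs
    rw [ContinuousLinearMap.spectrum_subset_Icc_iff hy] at hys
    intro w
    have h1 := hxs w
    have h2 := hys w
    rw [hya] at h2
    simp only [ContinuousLinearMap.reApplyInnerSelf_add, one_smul,
      ContinuousLinearMap.reApplyInnerSelf_real_smul] at h2 ⊢
    constructor <;> nlinarith [hτ.1, hτ.2]
  have hg : ContinuousOn (dslope f t₁) I := (continuousOn_dslope (hI.mem_nhds (hcd ht₁))).2
    ⟨hf.continuousOn, (hf.contDiffAt (hI.mem_nhds (hcd ht₁))).differentiableAt (by simp)⟩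
  rw [ContinuousLinearMap.le_iff_reApplyInnerSelf (cfc_predicate _ _) (cfc_predicate _ _)]
  intro v
  have := le_of_eventually_neg_mul_le
    (φ := fun τ ↦ (cfc (dslope f t₁) (x + τ • (k * star k))).reApplyInnerSelf v) ?_ ?_
  · simpa [← hk] using this
  · refine (ContinuousLinearMap.continuous_reApplyInnerSelf' v).comp_continuousOn ?_
    exact ContinuousOn.cfc' isCompact_Icc _ (by fun_prop) hsp (fun τ _ ↦ hsa τ) (hg.mono hcd)
  · intro τ hτ r hr
    have h := eventually_le_cfc_dslope_add_smul_sub hI hIc hf hconv hc hd ht₁ h11 h12 h21 h22 hJ (hsa τ)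
      (hsp τ (Ico_subset_Icc_self hτ)) k v hr
    simpa only [add_smul, add_assoc] using h

end FiniteDimensional

/-! ### Reduction from Hilbert spaces to finite dimension -/

section Compression

variable {H : Type*} [NormedAddCommGroup H] [InnerProductSpace ℂ H] [CompleteSpace H]
  {E : Type*} [NormedAddCommGroup E] [InnerProductSpace ℂ E] [CompleteSpace E]

/-- If the range of the isometry `V` contains `v, x v, …, x ^ n v`, then compression by `V`
preserves the quadratic form of `p(x)` at `v` for polynomials `p` of degree at most `n`. -/
theorem reApplyInnerSelf_aeval_compression {V : E →L[ℂ] H} (x : H →L[ℂ] H) (p : ℝ[X]) (v : H)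
    (hv : ∀ i ≤ p.natDegree, V (adjoint V ((x ^ i) v)) = (x ^ i) v) :
    (aeval (adjoint V ∘SL x ∘SL V) p).reApplyInnerSelf (adjoint V v) =
      (aeval x p).reApplyInnerSelf v := by
  have hpow : ∀ i ≤ p.natDegree, ((adjoint V ∘SL x ∘SL V) ^ i) (adjoint V v) =
      adjoint V ((x ^ i) v) := by
    intro i
    induction i with
    | zero => simp
    | succ i ih =>
      intro hi
      rw [pow_succ', mul_apply_eq_comp, ih (by omega), pow_succ', mul_apply_eq_comp]
      simp only [ContinuousLinearMap.comp_apply]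
      rw [hv i (by omega)]
  have h : (aeval (adjoint V ∘SL x ∘SL V) p) (adjoint V v) = adjoint V ((aeval x p) v) := by
    simp only [aeval_eq_sum_range, sum_apply, smul_apply, map_sum,
      ContinuousLinearMap.map_smul_of_tower]
    exact Finset.sum_congr rfl fun i hi ↦ by rw [hpow i (by simpa [Nat.lt_succ_iff] using hi)]
  have h0 : V (adjoint V v) = v := by simpa using hv 0 (Nat.zero_le _)
  rw [ContinuousLinearMap.reApplyInnerSelf, h, ContinuousLinearMap.adjoint_inner_left, h0,
    ContinuousLinearMap.reApplyInnerSelf]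

theorem reApplyInnerSelf_compression (V : E →L[ℂ] H) (x : H →L[ℂ] H) (u : E) :
    (adjoint V ∘SL x ∘SL V).reApplyInnerSelf u = x.reApplyInnerSelf (V u) := by
  simp [ContinuousLinearMap.reApplyInnerSelf, ContinuousLinearMap.adjoint_inner_left]

theorem isSelfAdjoint_compression (V : E →L[ℂ] H) {x : H →L[ℂ] H} (hx : IsSelfAdjoint x) :
    IsSelfAdjoint (adjoint V ∘SL x ∘SL V) := by
  rw [ContinuousLinearMap.isSelfAdjoint_iff']
  simp [ContinuousLinearMap.adjoint_comp, ContinuousLinearMap.comp_assoc, hx.adjoint_eq]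

theorem spectrum_compression_subset {V : E →L[ℂ] H} (hV : ∀ u, ‖V u‖ = ‖u‖) {x : H →L[ℂ] H}
    (hx : IsSelfAdjoint x) {c d : ℝ} (hxs : spectrum ℝ x ⊆ Icc c d) :
    spectrum ℝ (adjoint V ∘SL x ∘SL V) ⊆ Icc c d := by
  rw [ContinuousLinearMap.spectrum_subset_Icc_iff (isSelfAdjoint_compression V hx)]
  rw [ContinuousLinearMap.spectrum_subset_Icc_iff hx] at hxs
  intro u
  rw [reApplyInnerSelf_compression, ← hV u]
  exact hxs (V u)

/-- Every finite dimensional subspace is the range of an isometry from a Euclidean space living in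
a prescribed universe. -/
theorem exists_isometry_of_finiteDimensional (F : Submodule ℂ H) [FiniteDimensional ℂ F] :
    ∃ (n : ℕ) (V : EuclideanSpace ℂ (ULift.{u} (Fin n)) →L[ℂ] H),
      (∀ u, ‖V u‖ = ‖u‖) ∧ ∀ w ∈ F, V (adjoint V w) = w := by
  -- Lifting the index type puts the Euclidean space in the universe where convexity is assumed.
  let b := (stdOrthonormalBasis ℂ F).reindex Equiv.ulift.{u}.symm
  let V := F.subtypeₗᵢ.comp b.repr.symm.toLinearIsometry
  refine ⟨_, V.toContinuousLinearMap, fun u ↦ V.norm_map u, fun w hw ↦ ?_⟩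
  have h1 := V.adjoint_comp_self
  have h2 : w = V.toContinuousLinearMap (b.repr ⟨w, hw⟩) := by simp [V]
  have h3 : adjoint V.toContinuousLinearMap (V.toContinuousLinearMap (b.repr ⟨w, hw⟩)) =
      b.repr ⟨w, hw⟩ := by
    rw [← ContinuousLinearMap.comp_apply, h1]; rfl
  rw [h2, h3]

theorem abs_reApplyInnerSelf_cfc_sub_aeval_le {x : H →L[ℂ] H} (hx : IsSelfAdjoint x) {c d ε : ℝ}
    (hxs : spectrum ℝ x ⊆ Icc c d) (hε : 0 ≤ ε) {g : ℝ → ℝ} (hg : ContinuousOn g (Icc c d))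
    {p : ℝ[X]} (hp : ∀ t ∈ Icc c d, |p.eval t - g t| < ε) (v : H) :
    |(cfc g x).reApplyInnerSelf v - (aeval x p).reApplyInnerSelf v| ≤ ε * ‖v‖ ^ 2 := by
  rw [← ContinuousLinearMap.reApplyInnerSelf_sub]
  refine (ContinuousLinearMap.abs_reApplyInnerSelf_le _ v).trans ?_
  gcongr
  have hg' := hg.mono hxs
  rw [← cfc_polynomial p x, ← cfc_sub g (fun t ↦ p.eval t) x (by fun_prop) (by fun_prop)]
  refine norm_cfc_le hε fun t ht ↦ ?_
  rw [Real.norm_eq_abs, abs_sub_comm]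
  exact (hp t (hxs ht)).le

end Compression

theorem cfc_dslope_le_of_hilbert {H : Type v} [NormedAddCommGroup H] [InnerProductSpace ℂ H]
    [CompleteSpace H] {I : Set ℝ} (hI : IsOpen I) (hIc : I.OrdConnected) {f : ℝ → ℝ}
    (hf : ContDiffOn ℝ 2 f I) (hconv : OperatorConvexOn.{u} f I) {t₁ c d : ℝ}
    (hc : c ∈ I) (hd : d ∈ I) (ht₁ : t₁ ∈ Icc c d) {x y : H →L[ℂ] H} (hx : IsSelfAdjoint x)
    (hy : IsSelfAdjoint y) (hxs : spectrum ℝ x ⊆ Icc c d) (hys : spectrum ℝ y ⊆ Icc c d)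
    (hxy : x ≤ y) : cfc (dslope f t₁) x ≤ cfc (dslope f t₁) y := by
  have hcd : Icc c d ⊆ I := hIc.out hc hd
  have hg : ContinuousOn (dslope f t₁) (Icc c d) := ((continuousOn_dslope (hI.mem_nhds (hcd ht₁))).2
    ⟨hf.continuousOn, (hf.contDiffAt (hI.mem_nhds (hcd ht₁))).differentiableAt (by simp)⟩).mono hcd
  rw [ContinuousLinearMap.le_iff_reApplyInnerSelf (cfc_predicate _ _) (cfc_predicate _ _)]
  intro v
  refine le_of_forall_pos_le_add fun η hη ↦ ?_
  -- Four approximation errors of size `ε ‖v‖²` occur: `x`, `y` and their compressions. The `+ 1`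
  -- covers `v = 0`.
  set ε := η / (4 * (‖v‖ ^ 2 + 1)) with hεdef
  have hε : 0 < ε := by positivity
  have hεv : 4 * (ε * ‖v‖ ^ 2) ≤ η := by
    have : 4 * (ε * (‖v‖ ^ 2 + 1)) = η := by rw [hεdef]; field_simp
    nlinarith
  obtain ⟨p, hp⟩ := exists_polynomial_near_of_continuousOn c d _ hg ε hε
  -- On the span of these Krylov vectors, compression preserves the forms of `p(x)` and `p(y)` at
  -- `v`.
  set G : Set H := (fun i ↦ (x ^ i) v) '' Iic p.natDegree ∪ (fun i ↦ (y ^ i) v) '' Iic p.natDegree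
  have hG : G.Finite := ((finite_Iic _).image _).union ((finite_Iic _).image _)
  have := FiniteDimensional.span_of_finite ℂ hG
  obtain ⟨n, V, hV, hVF⟩ := exists_isometry_of_finiteDimensional.{u} (Submodule.span ℂ G)
  have hvx : ∀ i ≤ p.natDegree, V (adjoint V ((x ^ i) v)) = (x ^ i) v := fun i hi ↦
    hVF _ (Submodule.subset_span (Or.inl ⟨i, hi, rfl⟩))
  have hvy : ∀ i ≤ p.natDegree, V (adjoint V ((y ^ i) v)) = (y ^ i) v := fun i hi ↦
    hVF _ (Submodule.subset_span (Or.inr ⟨i, hi, rfl⟩))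
  have hv0 : V (adjoint V v) = v := by simpa using hvx 0 (Nat.zero_le _)
  have hx' := isSelfAdjoint_compression V hx
  have hy' := isSelfAdjoint_compression V hy
  have hxy' : adjoint V ∘SL x ∘SL V ≤ adjoint V ∘SL y ∘SL V := by
    rw [ContinuousLinearMap.le_iff_reApplyInnerSelf hx' hy']
    intro u
    rw [reApplyInnerSelf_compression, reApplyInnerSelf_compression]
    exact (ContinuousLinearMap.le_iff_reApplyInnerSelf hx hy).1 hxy _
  have hxs' := spectrum_compression_subset hV hx hxs
  have hys' := spectrum_compression_subset hV hy hys
  have key := (ContinuousLinearMap.le_iff_reApplyInnerSelf (cfc_predicate _ _)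
    (cfc_predicate _ _)).1 (cfc_dslope_le_of_finiteDimensional hI hIc hf hconv hc hd ht₁ hx' hy'
      hxs' hys' hxy') (adjoint V v)
  have hn : ‖adjoint V v‖ = ‖v‖ := by rw [← hV, hv0]
  have a1 := abs_reApplyInnerSelf_cfc_sub_aeval_le hx hxs hε.le hg hp v
  have a2 := abs_reApplyInnerSelf_cfc_sub_aeval_le hy hys hε.le hg hp v
  have a3 := abs_reApplyInnerSelf_cfc_sub_aeval_le hx' hxs' hε.le hg hp (adjoint V v)
  have a4 := abs_reApplyInnerSelf_cfc_sub_aeval_le hy' hys' hε.le hg hp (adjoint V v)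
  rw [reApplyInnerSelf_aeval_compression x p v hvx, hn] at a3
  rw [reApplyInnerSelf_aeval_compression y p v hvy, hn] at a4
  rw [abs_le] at a1 a2 a3 a4
  linarith [a1.2, a2.1, a3.1, a4.2]

/-! ### Reduction from C⋆-algebras to Hilbert spaces -/

section States

open scoped ComplexOrder

variable {A : Type v} [CStarAlgebra A] [PartialOrder A] [StarOrderedRing A]

/-- Positive functionals detect positivity of self-adjoint elements. -/
theorem exists_positiveLinearMap_re_neg {a : A} (ha : IsSelfAdjoint a) (hna : ¬ 0 ≤ a) :
    ∃ φ : A →ₚ[ℂ] ℂ, (φ a).re < 0 := by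
  obtain ⟨F, hF, hFa⟩ := (ProperCone.positive ℝ A).hyperplane_separation_point (x₀ := a)
    (by simpa using hna)
  simp only [ProperCone.mem_positive] at hF
  -- Symmetrising kills skew-adjoint elements, so the complex extension of `G` is real on
  -- self-adjoint ones. The resulting factor `2` does not affect signs.
  let G : Module.Dual ℝ A :=
    { toFun := fun z ↦ F (z + star z)
      map_add' := fun z w ↦ by rw [← map_add, star_add]; congr 1; abel
      map_smul' := fun c z ↦ by
        rw [star_smul, star_trivial, ← smul_add, map_smul, RingHom.id_apply] }
  have hGI : ∀ z : A, IsSelfAdjoint z → G (Complex.I • z) = 0 := fun z hz ↦ by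
    change F (Complex.I • z + star (Complex.I • z)) = 0
    rw [star_smul, hz.star_eq, Complex.star_def, Complex.conj_I, neg_smul, add_neg_cancel, map_zero]
  have hGs : ∀ z : A, IsSelfAdjoint z → G z = 2 * F z := fun z hz ↦ by
    change F (z + star z) = _
    rw [hz.star_eq, map_add, two_mul]
  refine ⟨PositiveLinearMap.mk₀ (Module.Dual.extendRCLike (𝕜 := ℂ) G) fun z hz ↦ ?_, ?_⟩
  · have hzs := IsSelfAdjoint.of_nonneg hz
    rw [Module.Dual.extendRCLike_apply]
    have : (0 : ℂ) ≤ ((2 * F z : ℝ) : ℂ) := by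
      have := hF z hz
      exact Complex.zero_le_real.2 (by positivity)
    simpa [hGI z hzs, hGs z hzs] using this
  · change RCLike.re (Module.Dual.extendRCLike (𝕜 := ℂ) G a) < 0
    rw [Module.Dual.re_extendRCLike_apply, hGs a ha]
    linarith

theorem le_of_forall_gns {x y : A} (hx : IsSelfAdjoint x) (hy : IsSelfAdjoint y)
    (h : ∀ φ : A →ₚ[ℂ] ℂ, φ.gnsStarAlgHom x ≤ φ.gnsStarAlgHom y) : x ≤ y := by
  by_contra hxy
  obtain ⟨φ, hφ⟩ := exists_positiveLinearMap_re_neg (hy.sub hx) (by rwa [sub_nonneg])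
  -- The class of `1` is the vector whose form recovers `φ`.
  have h1 := (ContinuousLinearMap.isPositive_def.1 (h φ)).2 (φ.toPreGNS 1 : φ.GNS)
  rw [← map_sub, ContinuousLinearMap.reApplyInnerSelf] at h1
  have h2 : inner ℂ (φ.gnsStarAlgHom (y - x) (φ.toPreGNS 1 : φ.GNS)) (φ.toPreGNS 1 : φ.GNS) =
      φ (y - x) := by
    change inner ℂ (φ.gnsNonUnitalStarAlgHom (y - x) (φ.toPreGNS 1 : φ.GNS)) _ = _
    rw [PositiveLinearMap.gnsNonUnitalStarAlgHom_apply_coe, UniformSpace.Completion.inner_coe,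
      PositiveLinearMap.preGNS_inner_def]
    simp [hx.star_eq, hy.star_eq]
  rw [h2] at h1
  exact absurd h1 (not_le.2 hφ)

theorem cfc_dslope_le {I : Set ℝ} (hI : IsOpen I) (hIc : I.OrdConnected) {f : ℝ → ℝ}
    (hf : ContDiffOn ℝ 2 f I) (hconv : OperatorConvexOn.{u} f I) {t₁ : ℝ}
    (ht₁ : t₁ ∈ I) {x y : A} (hx : IsSelfAdjoint x)
    (hy : IsSelfAdjoint y) (hxs : spectrum ℝ x ⊆ I) (hys : spectrum ℝ y ⊆ I)
    (hxy : x ≤ y) : cfc (dslope f t₁) x ≤ cfc (dslope f t₁) y := by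
  have hg : ContinuousOn (dslope f t₁) I := (continuousOn_dslope (hI.mem_nhds ht₁)).2
    ⟨hf.continuousOn, (hf.contDiffAt (hI.mem_nhds ht₁)).differentiableAt (by simp)⟩
  -- The extremes of this compact set lie in `I`, so they bound an interval inside `I` containing
  -- `t₁` and both spectra.
  set K := insert t₁ (spectrum ℝ x ∪ spectrum ℝ y) with hK
  have hKI : K ⊆ I := insert_subset ht₁ (union_subset hxs hys)
  have hKc : IsCompact K := ((spectrum.isCompact x).union (spectrum.isCompact y)).insert t₁
  have hKn : K.Nonempty := insert_nonempty _ _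
  have hKs : K ⊆ Icc (sInf K) (sSup K) := fun t ht ↦
    ⟨csInf_le hKc.bddBelow ht, le_csSup hKc.bddAbove ht⟩
  refine le_of_forall_gns (cfc_predicate _ _) (cfc_predicate _ _) fun φ ↦ ?_
  have hcont : Continuous φ.gnsStarAlgHom := map_continuous _
  have hsx := AlgHom.spectrum_apply_subset (φ.gnsStarAlgHom.toAlgHom.restrictScalars ℝ) x
  have hsy := AlgHom.spectrum_apply_subset (φ.gnsStarAlgHom.toAlgHom.restrictScalars ℝ) y
  rw [StarAlgHom.map_cfc φ.gnsStarAlgHom _ x (hg.mono hxs) hcont hx (hx.map _),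
    StarAlgHom.map_cfc φ.gnsStarAlgHom _ y (hg.mono hys) hcont hy (hy.map _)]
  refine cfc_dslope_le_of_hilbert hI hIc hf hconv (hKI (hKc.sInf_mem hKn)) (hKI (hKc.sSup_mem hKn))
    (hKs (mem_insert _ _)) (hx.map _) (hy.map _) ?_ ?_ (OrderHomClass.mono _ hxy)
  · exact hsx.trans fun t ht ↦ hKs (by simp [hK, ht])
  · exact hsy.trans fun t ht ↦ hKs (by simp [hK, ht])

end States

theorem isOpen_openInterval (a b : EReal) : IsOpen (openInterval a b) :=
  isOpen_Ioo.preimage continuous_coe_real_ereal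

theorem ordConnected_openInterval (a b : EReal) : (openInterval a b).OrdConnected :=
  ⟨fun _ hx _ hy _ hz ↦ ⟨hx.1.trans_le (EReal.coe_le_coe_iff.2 hz.1),
    (EReal.coe_le_coe_iff.2 hz.2).trans_lt hy.2⟩⟩

theorem mainTheorem6 (a b : EReal) (f : ℝ → ℝ)
    (hf : ContDiffOn ℝ 2 f (openInterval a b))
    (hconv : OperatorConvexOn.{u} f (openInterval a b))
    (t₁ : ℝ) (ht₁ : t₁ ∈ openInterval a b) :
    OperatorMonotoneOn.{v} (dividedDifferenceTransform t₁ f) (openInterval a b) := by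
  have hI := isOpen_openInterval a b
  refine ⟨(continuousOn_dslope (hI.mem_nhds ht₁)).2
    ⟨hf.continuousOn, (hf.contDiffAt (hI.mem_nhds ht₁)).differentiableAt (by simp)⟩, ?_⟩
  intro A _ _ _ X Y hX hY hXs hYs hXY
  exact cfc_dslope_le hI (ordConnected_openInterval a b) hf hconv ht₁ hX hY hXs hYs hXY
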